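/- All subspaces are linear. For $m>1$, a finite set $A$ and integers $1\le\kappa_\alpha\le m-1$ ($\alpha\in A$), let $G(m,(\kappa_\alpha))$ be the set of families $(\mathcal V_\alpha)_{\alpha\in A}$ of subspaces of $\mathbb R^m$ with $\operatorname{codim}\mathcal V_\alpha=\kappa_\alpha$. It is a product of Grassmannians, with its natural real analytic structure. A subset of it is an analytic subvariety if near every point of $G(m,(\kappa_\alpha))$ it is the set of common zeros of finitely many real analytic functions; it has positive codimension if it contains no nonempty open set. A snarl in $\mathbb R^m$ is a family of subspaces of $\mathbb R^m$, indexed by a finite set, with all codimensions in $[1,m-1]$. A splitting of a snarl $(\mathcal V_\alpha)_{\alpha\in A}$ is a snarl $(\mathcal W_\beta)_{\beta\in B}$ with $|B|=|A|+1$, $|A\cap B|=|A|-1$, $\mathcal W_\alpha=\mathcal V_\alpha$ for $\alpha\in A\cap B$ and, writing $A\setminus B=\{\alpha_0\}$ and $B\setminus A=\{\beta',\beta''\}$, with $\mathcal W_{\beta'}\cap\mathcal W_{\beta''}=\mathcal V_{\alpha_0}$ and $\operatorname{codim}\mathcal W_{\beta'}+\operatorname{codim}\mathcal W_{\beta''}=\operatorname{codim}\mathcal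 V_{\alpha_0}$. It is transverse if $A\setminus\{\alpha_0\}$ is the disjoint union of two nonempty sets $A',A''$ such that $\mathcal W_{\beta'}\cap\bigcap_{\alpha\in A'}\mathcal V_\alpha\ne\{0\}$ and $\mathcal W_{\beta''}\cap\bigcap_{\alpha\in A''}\mathcal V_\alpha\neq\{0\}$, and moreover $\mathcal W_{\beta'}+\mathcal W_{\beta''}=\mathbb R^m$, while $\mathcal W_{\beta'}+\mathcal V_{\alpha_0}$ and $\mathcal W_{\beta''}+\mathcal V_{\alpha_0}$ are proper subspaces. A snarl is one-dimensional if all its subspaces have codimension one. A one-dimensional snarl $(\mathcal V_\alpha)_{\alpha\in A}$ is in general position if for every $A'\subset A$ the annihilators of the $\mathcal V_\alpha$, $\alpha\in A'$, in the dual space of $\mathbb R^m$ together span a subspace of dimension $\min(|A'|,m)$. A resolution of a snarl $\mathfrak S$ is a finite sequence of snarls $\mathfrak S_0=\mathfrak S,\mathfrak S_1,\dots,\mathfrak S_N$ ($N\ge0$) such that $\mathfrak S_{k+1}$ is a transverse splitting of $\mathfrak S_k$ for $0\le k<N$ and $\mathfrak S_N$ is one-dimensional; $\mathfrak S_N$ is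 its terminal element. **Proposition.** Let $m>1$, let $A$ be a finite index set, and let $1\le\kappa_\alpha\le m-1$ for $\alpha\in A$ satisfy $$2\max_{\beta\in A}\kappa_\beta+\sum_{\alpha\in A}\kappa_\alpha\le 2m .$$ Assume that $|A|\ge3$ or that $\kappa_\alpha=1$ for all $\alpha\in A$. Then there is an analytic subvariety $X$ of positive codimension in $G(m,(\kappa_\alpha))$ such that every snarl $Q\in G(m,(\kappa_\alpha))\setminus X$ admits a resolution whose terminal element is in general position. -/

import Mathlib

open Module
open scoped Topology

/-- The codimension of a linear subspace. -/
noncomputable def codim {V : Type*} [AddCommGroup V] [Module ℝ V] (W : Submodule ℝ V) : ℕ :=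
  finrank ℝ (V ⧸ W)

/-- A snarl in the real vector space `V`: a finite index set `A` (a finite set of labels taken
from `ι`) and a family of linear subspaces of `V`, indexed by `A`, whose codimensions lie
in `[1, dim V - 1]`. -/
structure Snarl (ι V : Type*) [AddCommGroup V] [Module ℝ V] where
  index : Finset ι
  space : index → Submodule ℝ V
  one_le_codim : ∀ α, 1 ≤ codim (space α)
  codim_lt : ∀ α, codim (space α) < finrank ℝ V

namespace Snarl

variable {ι V : Type*} [AddCommGroup V] [Module ℝ V]

/-- The intersection of the subspaces of `S` with index in `A'`. -/
def inter (S : Snarl ι V) (A' : Finset S.index) : Submodule ℝ V :=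
  ⨅ α ∈ A', S.space α

/-- `T`, with index set `B`, is a splitting of `S`, with index set `A`, where
`A \ B = {α₀}` and `B \ A = {β', β''}`. -/
structure IsSplittingAt [DecidableEq ι] (S T : Snarl ι V)
    (α₀ : S.index) (β' β'' : T.index) : Prop where
  card_eq : T.index.card = S.index.card + 1
  card_inter : (S.index ∩ T.index).card + 1 = S.index.card
  sdiff_left : S.index \ T.index = {(α₀ : ι)}
  sdiff_right : T.index \ S.index = {(β' : ι), (β'' : ι)}
  space_eq : ∀ (α : ι) (hS : α ∈ S.index) (hT : α ∈ T.index),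
    T.space ⟨α, hT⟩ = S.space ⟨α, hS⟩
  inf_eq : T.space β' ⊓ T.space β'' = S.space α₀
  codim_add : codim (T.space β') + codim (T.space β'') = codim (S.space α₀)

/-- `T` is a transverse splitting of `S`. The distinguished indices are determined by `S` and `T`
up to exchanging `β'` and `β''`, and the condition is symmetric under that exchange. -/
def IsTransverseSplitting [DecidableEq ι] (S T : Snarl ι V) : Prop :=
  ∃ (α₀ : S.index) (β' β'' : T.index), IsSplittingAt S T α₀ β' β'' ∧
    ∃ A' A'' : Finset S.index,
      A'.Nonempty ∧ A''.Nonempty ∧ Disjoint A' A'' ∧ A' ∪ A'' = Finset.univ.erase α₀ ∧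
      0 < finrank ℝ ↥(T.space β' ⊓ S.inter A') ∧
      0 < finrank ℝ ↥(T.space β'' ⊓ S.inter A'') ∧
      T.space β' ⊔ T.space β'' = ⊤ ∧
      T.space β' ⊔ S.space α₀ ≠ ⊤ ∧
      T.space β'' ⊔ S.space α₀ ≠ ⊤

/-- A snarl is one-dimensional if all its subspaces have codimension one. -/
def IsOneDimensional (S : Snarl ι V) : Prop :=
  ∀ α, codim (S.space α) = 1

/-- The finite sequence `c 0, …, c N` is a resolution of `S`: a chain of transverse splittings
that starts at `S` and ends in a one-dimensional snarl. -/
structure IsResolution [DecidableEq ι] (S : Snarl ι V) (N : ℕ)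
    (c : Fin (N + 1) → Snarl ι V) : Prop where
  zero : c 0 = S
  step : ∀ k : Fin N, IsTransverseSplitting (c k.castSucc) (c k.succ)
  terminal : (c (Fin.last N)).IsOneDimensional

/-- General position of a one-dimensional snarl (a family of hyperplanes): for every set `A'` of
indices, the lines of linear functionals that define the hyperplanes with index in `A'` together
span a space of dimension `min |A'| (dim V)`. -/
def IsInGeneralPosition (S : Snarl ι V) : Prop :=
  S.IsOneDimensional ∧ ∀ A' : Finset S.index,
    finrank ℝ ↥(⨆ α ∈ A', (S.space α).dualAnnihilator) = min A'.card (finrank ℝ V)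

end Snarl

/-- Mathlib's Grassmannian of rank `k` quotients is the set of subspaces of codimension `k`. -/
theorem codim_grassmannian {V : Type*} [AddCommGroup V] [Module ℝ V] {k : ℕ}
    (W : Grassmannian ℝ V k) : codim W.toSubmodule = k := by
  have h := W.rankAtStalk_eq default
  rw [rankAtStalk_eq_finrank_of_free] at h
  simpa [codim] using h

/-- A subspace of codimension `k` as a point of the Grassmannian. -/
def grassmannianMk {V : Type*} [AddCommGroup V] [Module ℝ V] [FiniteDimensional ℝ V] {k : ℕ}
    (W : Submodule ℝ V) (hW : codim W = k) : Grassmannian ℝ V k where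
  toSubmodule := W
  finite_quotient := inferInstance
  projective_quotient := inferInstance
  rankAtStalk_eq := fun p => by
    rw [rankAtStalk_eq_finrank_of_free]
    simpa [codim] using hW

/-- The product of Grassmannians `G(m, (κ_α))`: families of linear subspaces `V_α` of `ℝ^m`,
with `V_α` of codimension `κ α`. -/
abbrev GrassmannProduct {I : Type*} (m : ℕ) (κ : I → ℕ) : Type _ :=
  ∀ α : I, Grassmannian ℝ (EuclideanSpace ℝ (Fin m)) (κ α)

/-- The snarl given by a point of the product of Grassmannians. -/
def GrassmannProduct.toSnarl {ι : Type*} {A : Finset ι} {m : ℕ} {κ : A → ℕ}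
    (hκ : ∀ α, 1 ≤ κ α ∧ κ α ≤ m - 1) (Q : GrassmannProduct m κ) :
    Snarl ι (EuclideanSpace ℝ (Fin m)) where
  index := A
  space := fun α => (Q α).toSubmodule
  one_le_codim := fun α => by rw [codim_grassmannian]; exact (hκ α).1
  codim_lt := fun α => by
    rw [codim_grassmannian, finrank_euclideanSpace_fin]
    have := hκ α
    omega

/-- For a linear map `f` from a subspace `W` of `ℝ^m` to its orthogonal complement, the graph
`{x + f x : x ∈ W}`. -/
noncomputable def graphSubspace {m : ℕ} (W : Submodule ℝ (EuclideanSpace ℝ (Fin m)))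
    (f : W →L[ℝ] Wᗮ) : Submodule ℝ (EuclideanSpace ℝ (Fin m)) :=
  LinearMap.range (W.subtype + Wᗮ.subtype ∘ₗ (f : W →ₗ[ℝ] Wᗮ))

theorem codim_graphSubspace {m : ℕ} (W : Submodule ℝ (EuclideanSpace ℝ (Fin m)))
    (f : W →L[ℝ] Wᗮ) : codim (graphSubspace W f) = codim W := by
  have hinj : Function.Injective (W.subtype + Wᗮ.subtype ∘ₗ (f : W →ₗ[ℝ] Wᗮ)) := by
    rw [← LinearMap.ker_eq_bot, LinearMap.ker_eq_bot']
    intro x hx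
    have h1 : (x : EuclideanSpace ℝ (Fin m)) = -(f x : EuclideanSpace ℝ (Fin m)) := by
      simpa [add_eq_zero_iff_eq_neg] using hx
    have h2 : (x : EuclideanSpace ℝ (Fin m)) ∈ W ⊓ Wᗮ :=
      ⟨x.2, h1 ▸ neg_mem (f x).2⟩
    rw [Submodule.inf_orthogonal_eq_bot] at h2
    exact Subtype.ext ((Submodule.mem_bot ℝ).1 h2)
  have h1 := LinearMap.finrank_range_of_inj hinj
  have h2 := Submodule.finrank_quotient_add_finrank (graphSubspace W f)
  have h3 := Submodule.finrank_quotient_add_finrank W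
  have h4 : finrank ℝ (graphSubspace W f) = finrank ℝ W := h1
  unfold codim
  omega

section Analytic

variable {I : Type*} {m : ℕ} {κ : I → ℕ}

/-- The model space of the standard (graph) chart of the product of Grassmannians centred
at `p`. -/
abbrev ChartSpace (p : GrassmannProduct m κ) : Type _ :=
  ∀ α : I, (p α).toSubmodule →L[ℝ] (p α).toSubmoduleᗮ

/-- The standard chart of the product of Grassmannians centred at `p`, as a parametrization:
`f` is sent to the family of graphs of the `f α`. Its image is the open set of all families
`(V_α)` with `V_α ∩ (p α)ᗮ = 0`, and `0` is sent to `p`. These charts, for all `p`, are the usual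
atlas that makes the product of Grassmannians a real analytic manifold. -/
noncomputable def graphChart (p : GrassmannProduct m κ) (f : ChartSpace p) :
    GrassmannProduct m κ :=
  fun α => grassmannianMk (graphSubspace (p α).toSubmodule (f α))
    ((codim_graphSubspace _ _).trans (codim_grassmannian (p α)))

/-- `X` is a real analytic subvariety: near every point `p` of the manifold (in `X` or not), `X`
is, in the chart centred at `p`, the set of common zeros of finitely many real analytic
functions. -/
def IsAnalyticSubvariety [Fintype I] (X : Set (GrassmannProduct m κ)) : Prop :=
  ∀ p : GrassmannProduct m κ, ∃ U : Set (ChartSpace p), IsOpen U ∧ 0 ∈ U ∧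
    ∃ (k : ℕ) (g : Fin k → ChartSpace p → ℝ), (∀ i, AnalyticOnNhd ℝ (g i) U) ∧
      ∀ f ∈ U, (graphChart p f ∈ X ↔ ∀ i, g i f = 0)

/-- An analytic subvariety has positive codimension if it contains no nonempty open subset of the
manifold, that is, if it has empty interior in every chart. -/
def HasPositiveCodimension [Fintype I] (X : Set (GrassmannProduct m κ)) : Prop :=
  ∀ p : GrassmannProduct m κ, interior {f : ChartSpace p | graphChart p f ∈ X} = ∅

end Analytic

/-!
Dually, a subspace of codimension `κ` is the orthogonal complement of a `κ`-dimensional space of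
normal vectors, and a splitting divides such a space of normals into a direct sum. So a resolution
amounts to a choice of a basis in each space of normals, and its terminal element is in general
position if all basis vectors together are generic: any `m` or fewer of them are independent
(`GenericVectors`).

Suppose that such bases exist. A snarl is then a labelling of the basis vectors `v j` by indices
(`labelledSnarl`), and a splitting moves one vector of a label that occurs at least twice to a new
label, while the rest gets another new label. The intersection of the hyperplanes orthogonal to `r`
of the vectors is nonzero if `r < m`. Hence the splitting is transverse as soon as the other labels
can be distributed to the two new ones so that each side carries fewer than `m` vectors
(`isTransverseSplitting_splitLabel`). The inequality `2 k + |J| ≤ 2 m`, where `|J|` is the number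
of vectors and `k` bounds the number of vectors with the same label, leaves enough room for that
(`exists_partition_of_weights`). It persists under splitting, so one can continue until all labels
are distinct (`labelledSnarl_exists_resolution`).

It remains to choose generic bases outside a proper analytic subvariety. Fix generic vectors
`x α i` and functionals `φ α i` dual to them for each `α`. A basis `y α` of the normals of the
subspace with index `α` is turned into a multiple of the basis dual to `φ α` (`reducedFrame`). This
is polynomial in `y α`, and a change of basis only rescales the result, so that genericity of the
reduced vectors depends on the point of the product of Grassmannians alone. The exceptional set
(`nongenericLocus`) is, in each chart, the zero set of a product of Gram determinants
(`genericityFunction`) of a frame that is affine in the chart coordinates (`chartFrame`). If it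
had an interior point, this function would vanish on a whole chart. But as a polynomial in the
frames it does not vanish at `x`, so it does not vanish at some frame that comes from the given
chart, since those frames are also described by the non-vanishing of a polynomial.
-/

/-! ### Generic vectors and their orthogonal complements -/

section GenericVectors

variable {J V : Type*} [NormedAddCommGroup V] [InnerProductSpace ℝ V]

/-- A family of vectors is generic if each of its subfamilies of at most `dim V` members is
linearly independent. -/
def GenericVectors (v : J → V) : Prop :=
  ∀ s : Finset J, s.card ≤ finrank ℝ V → LinearIndependent ℝ fun j : s => v j

/-- The subspace of all vectors orthogonal to `v j` for every `j ∈ s`. -/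
noncomputable def commonOrthogonal (v : J → V) (s : Finset J) : Submodule ℝ V :=
  (Submodule.span ℝ (v '' s))ᗮ

theorem mem_commonOrthogonal {v : J → V} {s : Finset J} {x : V} :
    x ∈ commonOrthogonal v s ↔ ∀ j ∈ s, inner ℝ (v j) x = 0 := by
  rw [commonOrthogonal, Submodule.mem_orthogonal]
  constructor
  · intro h j hj
    exact h _ (Submodule.subset_span ⟨j, hj, rfl⟩)
  · intro h u hu
    induction hu using Submodule.span_induction with
    | mem u hu => obtain ⟨j, hj, rfl⟩ := hu; exact h j hj
    | zero => simp
    | add u w _ _ hu hw => simp [inner_add_left, hu, hw]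
    | smul c u _ hu => simp [inner_smul_left, hu]

theorem commonOrthogonal_inf [DecidableEq J] (v : J → V) (s t : Finset J) :
    commonOrthogonal v s ⊓ commonOrthogonal v t = commonOrthogonal v (s ∪ t) := by
  ext x
  simp only [Submodule.mem_inf, mem_commonOrthogonal, Finset.mem_union]
  grind

theorem finrank_span_image_of_card_le {v : J → V} (hv : GenericVectors v) {s : Finset J}
    (hs : s.card ≤ finrank ℝ V) : finrank ℝ (Submodule.span ℝ (v '' s)) = s.card := by
  have h := finrank_span_eq_card (hv s hs)
  rw [Fintype.card_coe] at h
  rw [← h, Set.image_eq_range]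
  rfl

variable [FiniteDimensional ℝ V]

theorem finrank_span_image_of_generic {v : J → V} (hv : GenericVectors v) (s : Finset J) :
    finrank ℝ (Submodule.span ℝ (v '' s)) = min s.card (finrank ℝ V) := by
  rcases le_total s.card (finrank ℝ V) with hs | hs
  · rw [min_eq_left hs, finrank_span_image_of_card_le hv hs]
  · rw [min_eq_right hs]
    obtain ⟨t, hts, ht⟩ := Finset.exists_subset_card_eq hs
    refine le_antisymm (Submodule.finrank_le _) ?_
    calc finrank ℝ V = finrank ℝ (Submodule.span ℝ (v '' t)) := by
          rw [finrank_span_image_of_card_le hv ht.le, ht]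
      _ ≤ _ := Submodule.finrank_mono (Submodule.span_mono (Set.image_mono (by exact_mod_cast hts)))

theorem codim_add_finrank (W : Submodule ℝ V) : codim W + finrank ℝ W = finrank ℝ V :=
  Submodule.finrank_quotient_add_finrank W

theorem codim_orthogonal (U : Submodule ℝ V) : codim Uᗮ = finrank ℝ U := by
  have h1 := codim_add_finrank Uᗮ
  have h2 := Submodule.finrank_add_finrank_orthogonal U
  omega

theorem codim_commonOrthogonal {v : J → V} (hv : GenericVectors v) (s : Finset J) :
    codim (commonOrthogonal v s) = min s.card (finrank ℝ V) := by
  rw [commonOrthogonal, codim_orthogonal, finrank_span_image_of_generic hv]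

theorem finrank_commonOrthogonal_pos {v : J → V} (hv : GenericVectors v) {s : Finset J}
    (hs : s.card < finrank ℝ V) : 0 < finrank ℝ (commonOrthogonal v s) := by
  have h1 := codim_add_finrank (commonOrthogonal v s)
  rw [codim_commonOrthogonal hv] at h1
  omega

theorem finrank_dualAnnihilator (W : Submodule ℝ V) : finrank ℝ W.dualAnnihilator = codim W := by
  have h1 := codim_add_finrank W
  have h2 := Subspace.finrank_add_finrank_dualAnnihilator_eq W
  omega

end GenericVectors

/-! ### Distributing weights -/

/-- A finite family of at least two weights can be distributed over two nonempty boxes of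
capacities `p` and `q` as soon as each weight fits into either box and the capacities exceed the
total weight by nearly the largest weight: a maximal proper part that fits into the first box
leaves a rest that fits into the second one. -/
theorem exists_partition_of_weights {X : Type*} [DecidableEq X] (B : Finset X) (w : X → ℕ)
    {p q k : ℕ} (hB : 2 ≤ B.card) (hwk : ∀ x ∈ B, w x ≤ k) (hp : ∀ x ∈ B, w x ≤ p)
    (hq : ∀ x ∈ B, w x ≤ q) (hsum : ∑ x ∈ B, w x + k ≤ p + q + 1) :
    ∃ A' A'' : Finset X, A'.Nonempty ∧ A''.Nonempty ∧ Disjoint A' A'' ∧ A' ∪ A'' = B ∧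
      ∑ x ∈ A', w x ≤ p ∧ ∑ x ∈ A'', w x ≤ q := by
  classical
  let F := B.powerset.filter fun S => S.Nonempty ∧ S ≠ B ∧ ∑ x ∈ S, w x ≤ p
  have hF : F.Nonempty := by
    obtain ⟨x, hx⟩ := Finset.card_pos.1 (by omega : 0 < B.card)
    refine ⟨{x}, ?_⟩
    simp only [F, Finset.mem_filter, Finset.mem_powerset, Finset.singleton_subset_iff,
      Finset.singleton_nonempty, Finset.sum_singleton, true_and]
    refine ⟨hx, ?_, hp x hx⟩
    rintro rfl
    simp at hB
  obtain ⟨S, hS, hmax⟩ := F.exists_max_image Finset.card hF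
  simp only [F, Finset.mem_filter, Finset.mem_powerset] at hS hmax
  obtain ⟨hSB, hSn, hSne, hSp⟩ := hS
  have hsplit := Finset.sum_sdiff (f := w) hSB
  have hrest : (B \ S).Nonempty :=
    Finset.sdiff_nonempty.2 fun h => hSne (Finset.Subset.antisymm hSB h)
  refine ⟨S, B \ S, hSn, hrest, Finset.disjoint_sdiff, Finset.union_sdiff_of_subset hSB, hSp, ?_⟩
  obtain ⟨x, hx⟩ := hrest
  have hxB := (Finset.mem_sdiff.1 hx).1
  have hxS := (Finset.mem_sdiff.1 hx).2
  by_cases h1 : insert x S = B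
  · have : B \ S = {x} := by
      rw [← h1]; ext y; simp only [Finset.mem_sdiff, Finset.mem_insert, Finset.mem_singleton]
      grind
    rw [this, Finset.sum_singleton]
    exact hq x hxB
  · by_contra hlt
    have h2 : ¬ ∑ y ∈ insert x S, w y ≤ p := fun h => by
      have := hmax (insert x S) ⟨Finset.insert_subset hxB hSB, Finset.insert_nonempty _ _, h1, h⟩
      rw [Finset.card_insert_of_notMem hxS] at this
      omega
    rw [Finset.sum_insert hxS] at h2
    have := hwk x hxB
    omega

/-! ### Snarls of labelled vectors -/

section LabelledSnarl

variable {ι J V : Type*} [DecidableEq ι] [Fintype J]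
  [NormedAddCommGroup V] [InnerProductSpace ℝ V] [FiniteDimensional ℝ V]

/-- The set of members of `J` with label `α`. -/
def labelFiber (π : J → ι) (α : ι) : Finset J := Finset.univ.filter fun j => π j = α

theorem mem_labelFiber {π : J → ι} {α : ι} {j : J} : j ∈ labelFiber π α ↔ π j = α := by
  simp [labelFiber]

theorem labelFiber_card_pos {π : J → ι} {α : ι} (h : α ∈ Finset.univ.image π) :
    0 < (labelFiber π α).card := by
  obtain ⟨j, -, rfl⟩ := Finset.mem_image.1 h
  exact Finset.card_pos.2 ⟨j, mem_labelFiber.2 rfl⟩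

/-- The snarl obtained from generic vectors `v j` and a labelling `π` of `J`: its index set is the
set of labels, and its subspace with index `α` is orthogonal to the `v j` with label `α`. -/
noncomputable def labelledSnarl {v : J → V} (hv : GenericVectors v) (π : J → ι)
    (hπ : ∀ α, (labelFiber π α).card < finrank ℝ V) : Snarl ι V where
  index := Finset.univ.image π
  space := fun α => commonOrthogonal v (labelFiber π α)
  one_le_codim := fun α => by
    rw [codim_commonOrthogonal hv]
    have := labelFiber_card_pos α.2
    have := hπ α
    omega
  codim_lt := fun α => by
    rw [codim_commonOrthogonal hv]
    have := hπ α
    omega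

variable [DecidableEq J]

theorem labelledSnarl_inter {v : J → V} (hv : GenericVectors v) (π : J → ι)
    (hπ : ∀ α, (labelFiber π α).card < finrank ℝ V)
    (A' : Finset (labelledSnarl hv π hπ).index) :
    (labelledSnarl hv π hπ).inter A' =
      commonOrthogonal v (A'.biUnion fun α => labelFiber π α) := by
  ext x
  simp only [Snarl.inter, Submodule.mem_iInf]
  change (∀ α ∈ A', x ∈ commonOrthogonal v (labelFiber π α)) ↔ _
  simp only [mem_commonOrthogonal, mem_labelFiber, Finset.mem_biUnion]
  grind

theorem card_biUnion_labelFiber {X : Finset ι} (π : J → ι) (A' : Finset X) :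
    (A'.biUnion fun α => labelFiber π α).card = ∑ α ∈ A', (labelFiber π α).card := by
  refine Finset.card_biUnion fun α _ β _ hne => ?_
  rw [Function.onFun, Finset.disjoint_left]
  intro j h1 h2
  rw [mem_labelFiber] at h1 h2
  exact hne (Subtype.ext (h1.symm.trans h2))

/-- Give `j₀` the new label `β'`, and the other members with the label of `j₀` the new
label `β''`. -/
def splitLabel (π : J → ι) (j₀ : J) (β' β'' : ι) (j : J) : ι :=
  if j = j₀ then β' else if π j = π j₀ then β'' else π j

variable {π : J → ι} {j₀ : J} {β' β'' : ι}

theorem labelFiber_splitLabel_left (h' : β' ∉ Finset.univ.image π) (hne : β' ≠ β'') :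
    labelFiber (splitLabel π j₀ β' β'') β' = {j₀} := by
  ext j
  have : π j ≠ β' := fun h => h' (Finset.mem_image.2 ⟨j, Finset.mem_univ _, h⟩)
  simp only [mem_labelFiber, splitLabel, Finset.mem_singleton]
  grind

theorem labelFiber_splitLabel_right (h'' : β'' ∉ Finset.univ.image π) (hne : β' ≠ β'') :
    labelFiber (splitLabel π j₀ β' β'') β'' = (labelFiber π (π j₀)).erase j₀ := by
  ext j
  have : π j ≠ β'' := fun h => h'' (Finset.mem_image.2 ⟨j, Finset.mem_univ _, h⟩)
  simp only [mem_labelFiber, splitLabel, Finset.mem_erase]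
  grind

theorem labelFiber_splitLabel_of_ne {α : ι} (hα : α ≠ π j₀) (h1 : α ≠ β') (h2 : α ≠ β'') :
    labelFiber (splitLabel π j₀ β' β'') α = labelFiber π α := by
  ext j
  simp only [mem_labelFiber, splitLabel]
  grind

theorem image_splitLabel (h' : β' ∉ Finset.univ.image π) (h'' : β'' ∉ Finset.univ.image π)
    (h2 : 1 < (labelFiber π (π j₀)).card) :
    Finset.univ.image (splitLabel π j₀ β' β'') =
      insert β' (insert β'' ((Finset.univ.image π).erase (π j₀))) := by
  obtain ⟨j₁, hj₁, hne⟩ := Finset.exists_mem_ne h2 j₀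
  rw [mem_labelFiber] at hj₁
  ext α
  simp only [Finset.mem_image, Finset.mem_univ, true_and, Finset.mem_insert, Finset.mem_erase,
    splitLabel] at h' h'' ⊢
  constructor
  · rintro ⟨j, rfl⟩
    grind
  · rintro (rfl | rfl | ⟨h1, j, rfl⟩)
    · exact ⟨j₀, by simp⟩
    · exact ⟨j₁, by simp [hne, hj₁]⟩
    · exact ⟨j, by grind⟩

theorem labelFiber_splitLabel_card_le (h' : β' ∉ Finset.univ.image π)
    (h'' : β'' ∉ Finset.univ.image π) (hne : β' ≠ β'') {k : ℕ}
    (hk : ∀ α, (labelFiber π α).card ≤ k) (α : ι) :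
    (labelFiber (splitLabel π j₀ β' β'') α).card ≤ k := by
  have hj₀ : 0 < (labelFiber π (π j₀)).card :=
    labelFiber_card_pos (Finset.mem_image_of_mem _ (Finset.mem_univ _))
  by_cases h1 : α = β'
  · subst h1
    rw [labelFiber_splitLabel_left h' hne, Finset.card_singleton]
    exact hj₀.trans_le (hk _)
  by_cases h2 : α = β''
  · subst h2
    rw [labelFiber_splitLabel_right h'' hne]
    exact (Finset.card_erase_le).trans (hk _)
  by_cases h3 : α = π j₀
  · have : labelFiber (splitLabel π j₀ β' β'') α = ∅ := by
      ext j
      simp only [mem_labelFiber, splitLabel, Finset.notMem_empty, iff_false]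
      grind
    rw [this]; simp
  · rw [labelFiber_splitLabel_of_ne h3 h1 h2]
    exact hk α

/-- Splitting one vector off a fiber of the labelling is a transverse splitting of snarls. By the
numerical hypothesis the remaining subspaces can be distributed so that the codimensions on either
side add up to less than `dim V`; this makes both intersections nonzero. -/
theorem isTransverseSplitting_splitLabel {v : J → V} (hv : GenericVectors v)
    (hπ : ∀ α, (labelFiber π α).card < finrank ℝ V)
    (h' : β' ∉ Finset.univ.image π) (h'' : β'' ∉ Finset.univ.image π) (hne : β' ≠ β'')
    (h2 : 1 < (labelFiber π (π j₀)).card) {k : ℕ} (hk : ∀ α, (labelFiber π α).card ≤ k)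
    (hkJ : 2 * k + Fintype.card J ≤ 2 * finrank ℝ V) (h3 : 3 ≤ (Finset.univ.image π).card)
    (hπ' : ∀ α, (labelFiber (splitLabel π j₀ β' β'') α).card < finrank ℝ V) :
    (labelledSnarl hv π hπ).IsTransverseSplitting
      (labelledSnarl hv (splitLabel π j₀ β' β'') hπ') := by
  have himg := image_splitLabel h' h'' h2
  have hα₀ : π j₀ ∈ Finset.univ.image π := Finset.mem_image_of_mem _ (Finset.mem_univ _)
  have hβ'T : β' ∈ Finset.univ.image (splitLabel π j₀ β' β'') := by rw [himg]; simp
  have hβ''T : β'' ∈ Finset.univ.image (splitLabel π j₀ β' β'') := by rw [himg]; simp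
  have hj₀ : j₀ ∈ labelFiber π (π j₀) := mem_labelFiber.2 rfl
  have hcard : ((labelFiber π (π j₀)).erase j₀).card + 1 = (labelFiber π (π j₀)).card :=
    Finset.card_erase_add_one hj₀
  set S := labelledSnarl hv π hπ
  set T := labelledSnarl hv (splitLabel π j₀ β' β'') hπ'
  have hTβ' : T.space ⟨β', hβ'T⟩ = commonOrthogonal v {j₀} := by
    change commonOrthogonal v (labelFiber _ β') = _
    rw [labelFiber_splitLabel_left h' hne]
  have hTβ'' : T.space ⟨β'', hβ''T⟩ =
      commonOrthogonal v ((labelFiber π (π j₀)).erase j₀) := by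
    change commonOrthogonal v (labelFiber _ β'') = _
    rw [labelFiber_splitLabel_right h'' hne]
  have hSα₀ : S.space ⟨π j₀, hα₀⟩ = commonOrthogonal v (labelFiber π (π j₀)) := rfl
  have hlt := hπ (π j₀)
  have hinf : T.space ⟨β', hβ'T⟩ ⊓ T.space ⟨β'', hβ''T⟩ = S.space ⟨π j₀, hα₀⟩ := by
    rw [hTβ', hTβ'', hSα₀, commonOrthogonal_inf]
    congr 1
    rw [Finset.union_comm, ← Finset.insert_eq_of_mem hj₀]
    ext j; simp; grind
  have hcodim : codim (T.space ⟨β', hβ'T⟩) + codim (T.space ⟨β'', hβ''T⟩) =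
      codim (S.space ⟨π j₀, hα₀⟩) := by
    rw [hTβ', hTβ'', hSα₀]
    simp only [codim_commonOrthogonal hv, Finset.card_singleton]
    omega
  refine ⟨⟨π j₀, hα₀⟩, ⟨β', hβ'T⟩, ⟨β'', hβ''T⟩, ?_, ?_⟩
  · refine ⟨?_, ?_, ?_, ?_, ?_, hinf, hcodim⟩
    · change (Finset.univ.image (splitLabel π j₀ β' β'')).card = (Finset.univ.image π).card + 1
      rw [himg, Finset.card_insert_of_notMem, Finset.card_insert_of_notMem,
        Finset.card_erase_add_one hα₀]
      · exact fun h => h'' (Finset.mem_of_mem_erase h)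
      · rw [Finset.mem_insert]
        rintro (h | h)
        · exact hne h
        · exact h' (Finset.mem_of_mem_erase h)
    · change (Finset.univ.image π ∩ Finset.univ.image (splitLabel π j₀ β' β'')).card + 1 =
        (Finset.univ.image π).card
      rw [← Finset.card_erase_add_one hα₀, himg]
      congr 2
      ext x
      simp only [Finset.mem_inter, Finset.mem_insert, Finset.mem_erase]
      grind
    · change Finset.univ.image π \ Finset.univ.image (splitLabel π j₀ β' β'') = _
      rw [himg]
      ext x
      simp only [Finset.mem_sdiff, Finset.mem_insert, Finset.mem_erase, Finset.mem_singleton]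
      grind
    · change Finset.univ.image (splitLabel π j₀ β' β'') \ Finset.univ.image π = _
      rw [himg]
      ext x
      simp only [Finset.mem_sdiff, Finset.mem_insert, Finset.mem_erase, Finset.mem_singleton]
      grind
    · intro α hαS hαT
      change commonOrthogonal v (labelFiber _ α) = commonOrthogonal v (labelFiber _ α)
      change α ∈ Finset.univ.image π at hαS
      change α ∈ Finset.univ.image (splitLabel π j₀ β' β'') at hαT
      rw [himg, Finset.mem_insert, Finset.mem_insert, Finset.mem_erase] at hαT
      rw [labelFiber_splitLabel_of_ne] <;> grind
  · have htotal : ∑ α : Finset.univ.image π, (labelFiber π α).card = Fintype.card J := by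
      rw [← card_biUnion_labelFiber, ← Finset.card_univ]
      congr 1
      ext j
      simp [mem_labelFiber]
    rw [← Finset.sum_erase_add _ _ (Finset.mem_univ (⟨π j₀, hα₀⟩ : Finset.univ.image π))] at htotal
    change _ + (labelFiber π (π j₀)).card = _ at htotal
    have hB : (Finset.univ.erase (⟨π j₀, hα₀⟩ : Finset.univ.image π)).card + 1 =
        (Finset.univ.image π).card := by
      rw [Finset.card_erase_add_one (Finset.mem_univ _), Finset.card_univ, Fintype.card_coe]
    have hpos (α : Finset.univ.image π) : 1 ≤ (labelFiber π α).card := labelFiber_card_pos α.2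
    -- a third label carries a vector outside the fibers of `x` and of `π j₀`
    have hroom : ∀ x ∈ Finset.univ.erase (⟨π j₀, hα₀⟩ : Finset.univ.image π),
        (labelFiber π x).card + (labelFiber π (π j₀)).card + 1 ≤ Fintype.card J := by
      intro x hx
      obtain ⟨y, hy, hyx⟩ := Finset.exists_mem_ne
        (s := Finset.univ.erase (⟨π j₀, hα₀⟩ : Finset.univ.image π)) (by omega) x
      have h1 := Finset.sum_erase_add _ (fun α : Finset.univ.image π => (labelFiber π α).card) hx
      have h2 := Finset.single_le_sum (f := fun α : Finset.univ.image π => (labelFiber π α).card)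
        (fun _ _ => Nat.zero_le _) (Finset.mem_erase.2 ⟨hyx, hy⟩)
      have h3 := hpos y
      omega
    have hk₀ := hk (π j₀)
    -- next to the one vector with label `β'`, up to `dim V - 2` others can be orthogonal to a common
    -- nonzero vector; similarly for the remaining fiber with label `β''`
    obtain ⟨A', A'', hA', hA'', hdisj, hunion, hs', hs''⟩ :=
      exists_partition_of_weights (Finset.univ.erase (⟨π j₀, hα₀⟩ : Finset.univ.image π))
        (fun α => (labelFiber π α).card) (p := finrank ℝ V - 2)
        (q := finrank ℝ V - (labelFiber π (π j₀)).card) (k := k) (by omega)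
        (fun x _ => hk x)
        (fun x hx => by have := hroom x hx; have := hk x; omega)
        (fun x hx => by have := hroom x hx; have := hk x; omega)
        (by omega)
    rw [← card_biUnion_labelFiber] at hs' hs''
    refine ⟨A', A'', hA', hA'', hdisj, hunion, ?_, ?_, ?_, ?_, ?_⟩
    · rw [hTβ', show S.inter A' = _ from labelledSnarl_inter hv π hπ A', commonOrthogonal_inf]
      refine finrank_commonOrthogonal_pos hv ((Finset.card_union_le _ _).trans_lt ?_)
      change Finset.card {j₀} + Finset.card (A'.biUnion fun α => labelFiber π α) < _
      rw [Finset.card_singleton]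
      omega
    · rw [hTβ'', show S.inter A'' = _ from labelledSnarl_inter hv π hπ A'', commonOrthogonal_inf]
      refine finrank_commonOrthogonal_pos hv ((Finset.card_union_le _ _).trans_lt ?_)
      change _ + Finset.card (A''.biUnion fun α => labelFiber π α) < _
      omega
    · apply Submodule.eq_top_of_finrank_eq
      have h1 := Submodule.finrank_sup_add_finrank_inf_eq (T.space ⟨β', hβ'T⟩)
        (T.space ⟨β'', hβ''T⟩)
      rw [hinf] at h1
      have h2 := codim_add_finrank (T.space ⟨β', hβ'T⟩)
      have h3 := codim_add_finrank (T.space ⟨β'', hβ''T⟩)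
      have h4 := codim_add_finrank (S.space ⟨π j₀, hα₀⟩)
      omega
    · rw [← hinf, sup_inf_self]
      intro h
      have h1 := T.one_le_codim ⟨β', hβ'T⟩
      have h2 := codim_add_finrank (T.space ⟨β', hβ'T⟩)
      rw [h, finrank_top] at h2
      rw [h] at h1
      omega
    · rw [← hinf, inf_comm, sup_inf_self]
      intro h
      have h1 := T.one_le_codim ⟨β'', hβ''T⟩
      have h2 := codim_add_finrank (T.space ⟨β'', hβ''T⟩)
      rw [h, finrank_top] at h2
      rw [h] at h1
      omega

end LabelledSnarl

/-! ### Resolutions -/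

section Resolution

theorem Snarl.ext_space {ι V : Type*} [AddCommGroup V] [Module ℝ V] {S T : Snarl ι V}
    (hindex : S.index = T.index)
    (hspace : ∀ α (hS : α ∈ S.index) (hT : α ∈ T.index), S.space ⟨α, hS⟩ = T.space ⟨α, hT⟩) :
    S = T := by
  obtain ⟨A, V, _, _⟩ := S
  obtain ⟨B, W, _, _⟩ := T
  obtain rfl : A = B := hindex
  obtain rfl : V = W := funext fun α => hspace α α.2 α.2
  rfl

theorem Snarl.IsResolution.cons {ι V : Type*} [AddCommGroup V] [Module ℝ V] [DecidableEq ι]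
    {S T : Snarl ι V} {N : ℕ} {c : Fin (N + 1) → Snarl ι V} (hST : S.IsTransverseSplitting T)
    (hc : T.IsResolution N c) :
    S.IsResolution (N + 1) (Fin.cons S c : Fin (N + 1 + 1) → Snarl ι V) where
  zero := rfl
  step := by
    intro k
    induction k using Fin.cases with
    | zero =>
      rw [Fin.cons_succ, hc.zero]
      exact hST
    | succ k =>
      rw [Fin.cons_succ, ← Fin.succ_castSucc, Fin.cons_succ]
      exact hc.step k
  terminal := by
    rw [← Fin.succ_last, Fin.cons_succ]
    exact hc.terminal

/-- The annihilators of some subspaces of a snarl together span the annihilator of the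
intersection. -/
theorem Snarl.iSup_dualAnnihilator {ι V : Type*} [AddCommGroup V] [Module ℝ V]
    [FiniteDimensional ℝ V] (S : Snarl ι V) (A' : Finset S.index) :
    ⨆ α ∈ A', (S.space α).dualAnnihilator = (S.inter A').dualAnnihilator := by
  have h := Subspace.dualAnnihilator_iInf_eq fun α : A' => S.space α
  rw [Snarl.inter, iSup_subtype', iInf_subtype']
  exact h.symm

variable {ι J V : Type*} [DecidableEq ι] [Fintype J] [DecidableEq J]
  [NormedAddCommGroup V] [InnerProductSpace ℝ V] [FiniteDimensional ℝ V]

/-- If all labels are distinct, the hyperplanes orthogonal to generic vectors are in general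
position: the annihilators of some of them together form the annihilator of their intersection. -/
theorem labelledSnarl_isInGeneralPosition {v : J → V} (hv : GenericVectors v) (π : J → ι)
    (hπ : ∀ α, (labelFiber π α).card < finrank ℝ V) (h1 : ∀ α, (labelFiber π α).card ≤ 1) :
    (labelledSnarl hv π hπ).IsInGeneralPosition := by
  have hfiber (α : Finset.univ.image π) : (labelFiber π α).card = 1 :=
    (h1 α).antisymm (labelFiber_card_pos α.2)
  refine ⟨fun α => ?_, fun A' => ?_⟩
  · change codim (commonOrthogonal v (labelFiber π α)) = 1
    have h2 := hπ α
    rw [codim_commonOrthogonal hv]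
    rw [hfiber α] at h2 ⊢
    omega
  · rw [Snarl.iSup_dualAnnihilator, finrank_dualAnnihilator, labelledSnarl_inter,
      codim_commonOrthogonal hv]
    congr 1
    refine (card_biUnion_labelFiber π A').trans ?_
    exact (Finset.sum_congr rfl fun α _ => hfiber α).trans (Finset.card_eq_sum_ones A').symm

/-- A labelled snarl is resolved by splitting off one vector at a time. -/
theorem labelledSnarl_exists_resolution [Infinite ι] {v : J → V} (hv : GenericVectors v) {k : ℕ}
    (hkJ : 2 * k + Fintype.card J ≤ 2 * finrank ℝ V) (π : J → ι)
    (hπ : ∀ α, (labelFiber π α).card < finrank ℝ V) (hk : ∀ α, (labelFiber π α).card ≤ k)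
    (h3 : 3 ≤ (Finset.univ.image π).card ∨ ∀ α, (labelFiber π α).card ≤ 1) :
    ∃ (N : ℕ) (c : Fin (N + 1) → Snarl ι V), (labelledSnarl hv π hπ).IsResolution N c ∧
      (c (Fin.last N)).IsInGeneralPosition := by
  induction hn : Fintype.card J - (Finset.univ.image π).card generalizing π with
  | zero =>
    have hcard : (Finset.univ.image π).card = (Finset.univ : Finset J).card :=
      Finset.card_image_le.antisymm (by rw [Finset.card_univ]; omega)
    have hgp := labelledSnarl_isInGeneralPosition hv π hπ fun α =>
      Finset.card_le_one.2 fun i hi j hj => Finset.card_image_iff.1 hcard (Finset.mem_coe.2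
        (Finset.mem_univ i)) (Finset.mem_coe.2 (Finset.mem_univ j))
        ((mem_labelFiber.1 hi).trans (mem_labelFiber.1 hj).symm)
    exact ⟨0, fun _ => labelledSnarl hv π hπ, ⟨rfl, fun i => i.elim0, hgp.1⟩, hgp⟩
  | succ n ih =>
    by_cases h1 : ∀ α, (labelFiber π α).card ≤ 1
    · have hgp := labelledSnarl_isInGeneralPosition hv π hπ h1
      exact ⟨0, fun _ => labelledSnarl hv π hπ, ⟨rfl, fun i => i.elim0, hgp.1⟩, hgp⟩
    have h3' := h3.resolve_right h1
    push Not at h1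
    obtain ⟨α, hα⟩ := h1
    obtain ⟨j₀, hj₀⟩ := Finset.card_pos.1 (by omega : 0 < (labelFiber π α).card)
    obtain rfl := mem_labelFiber.1 hj₀
    obtain ⟨β', h'⟩ := Infinite.exists_notMem_finset (Finset.univ.image π)
    obtain ⟨β'', hβ''⟩ := Infinite.exists_notMem_finset (insert β' (Finset.univ.image π))
    rw [Finset.mem_insert, not_or] at hβ''
    obtain ⟨hne, h''⟩ := hβ''
    have hk' := labelFiber_splitLabel_card_le (j₀ := j₀) h' h'' (Ne.symm hne) hk
    have hπ' (α) : (labelFiber (splitLabel π j₀ β' β'') α).card < finrank ℝ V := by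
      have h := labelFiber_splitLabel_card_le (j₀ := j₀) h' h'' (Ne.symm hne)
        (fun α => Nat.le_sub_one_of_lt (hπ α)) α
      have := hπ (π j₀)
      omega
    have hcard : (Finset.univ.image (splitLabel π j₀ β' β'')).card =
        (Finset.univ.image π).card + 1 := by
      rw [image_splitLabel h' h'' hα, Finset.card_insert_of_notMem, Finset.card_insert_of_notMem,
        Finset.card_erase_add_one (Finset.mem_image_of_mem _ (Finset.mem_univ _))]
      · exact fun h => h'' (Finset.mem_of_mem_erase h)
      · rw [Finset.mem_insert, not_or]
        exact ⟨Ne.symm hne, fun h => h' (Finset.mem_of_mem_erase h)⟩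
    obtain ⟨N, c, hc, hgp⟩ := ih (splitLabel π j₀ β' β'') hπ' hk' (Or.inl (by omega)) (by omega)
    refine ⟨N + 1, Fin.cons _ c, hc.cons (isTransverseSplitting_splitLabel hv hπ h' h''
      (Ne.symm hne) hα hk hkJ h3' hπ'), ?_⟩
    rwa [← Fin.succ_last, Fin.cons_succ]

end Resolution

open scoped ContDiff

/-! ### Analytic functions -/

section AnalyticTools

variable {F : Type*} [NormedAddCommGroup F] [NormedSpace ℝ F]

theorem ContDiff.matrix_det {n : Type*} [Fintype n] [DecidableEq n] {M : F → Matrix n n ℝ}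
    (hM : ∀ i j, ContDiff ℝ ω fun x => M x i j) : ContDiff ℝ ω fun x => (M x).det := by
  simp only [Matrix.det_apply]
  refine ContDiff.sum fun σ _ => ContDiff.const_smul _ ?_
  exact contDiff_prod fun i _ => hM _ _

theorem ContDiff.matrix_adjugate {n : Type*} [Fintype n] [DecidableEq n] {M : F → Matrix n n ℝ}
    (hM : ∀ i j, ContDiff ℝ ω fun x => M x i j) (i j : n) :
    ContDiff ℝ ω fun x => (M x).adjugate i j := by
  simp only [Matrix.adjugate_apply]
  refine ContDiff.matrix_det fun a b => ?_
  by_cases h : a = j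
  · subst h
    simpa using contDiff_const
  · simpa [Matrix.updateRow_ne h] using hM a b

theorem eq_zero_of_contDiff_of_eventuallyEq {g : F → ℝ} (hg : ContDiff ℝ ω g) {a : F}
    (ha : g =ᶠ[𝓝 a] 0) (x : F) : g x = 0 :=
  (contDiff_omega_iff_analyticOnNhd.1 hg).eqOn_zero_of_preconnected_of_eventuallyEq_zero
    isPreconnected_univ (Set.mem_univ a) ha (Set.mem_univ x)

/-- Two analytic functions on a normed space, neither of them identically zero, are simultaneously
nonzero somewhere. -/
theorem exists_ne_zero_and_ne_zero {g h : F → ℝ} (hg : ContDiff ℝ ω g) (hh : ContDiff ℝ ω h)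
    {a b : F} (ha : g a ≠ 0) (hb : h b ≠ 0) : ∃ x, g x ≠ 0 ∧ h x ≠ 0 := by
  by_contra! H
  refine hb (eq_zero_of_contDiff_of_eventuallyEq hh (a := a) ?_ b)
  filter_upwards [hg.continuous.continuousAt.eventually_ne ha] with x hx using H x hx

end AnalyticTools

/-! ### Reduced frames -/

section ReducedFrame

variable {E : Type*} [NormedAddCommGroup E] [NormedSpace ℝ E] {n : ℕ}

/-- For linear functionals `φ j` and vectors `y j`, the multiple by `det (φ j (y i))` of the basis
of `span y` dual to the `φ j`. The adjugate replaces the inverse of the matrix `(φ j (y i))`, so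
that the result is polynomial in `y`; up to scaling it depends only on the span of `y`. -/
noncomputable def reducedFrame (φ : Fin n → E →L[ℝ] ℝ) (y : Fin n → E) (i : Fin n) : E :=
  ∑ j, (Matrix.of fun i j => φ j (y i)).adjugate i j • y j

theorem reducedFrame_eq_self {φ : Fin n → E →L[ℝ] ℝ} {y : Fin n → E}
    (h : ∀ i j, φ j (y i) = if i = j then 1 else 0) : reducedFrame φ y = y := by
  have h1 : (Matrix.of fun i j => φ j (y i)) = 1 := by
    ext i j
    simp [h, Matrix.one_apply]
  ext1 i
  simp [reducedFrame, h1, Matrix.one_apply]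

theorem reducedFrame_mem {φ : Fin n → E →L[ℝ] ℝ} {y : Fin n → E} {U : Submodule ℝ E}
    (hy : ∀ i, y i ∈ U) (i : Fin n) : reducedFrame φ y i ∈ U :=
  Submodule.sum_mem _ fun j _ => Submodule.smul_mem _ _ (hy j)

/-- A change of frame multiplies the reduced frame by the determinant of the change. -/
theorem reducedFrame_change (φ : Fin n → E →L[ℝ] ℝ) {y y' : Fin n → E}
    (C : Matrix (Fin n) (Fin n) ℝ) (hC : ∀ i, y' i = ∑ j, C i j • y j) (i : Fin n) :
    reducedFrame φ y' i = C.det • reducedFrame φ y i := by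
  have h1 : (Matrix.of fun i j => φ j (y' i)) = C * Matrix.of fun i j => φ j (y i) := by
    ext i j
    simp [hC, Matrix.mul_apply]
  set M := Matrix.of fun i j => φ j (y i) with hM
  have h2 : (C * M).adjugate * C = C.det • M.adjugate := by
    rw [Matrix.adjugate_mul_distrib, Matrix.mul_assoc, Matrix.adjugate_mul]
    simp
  calc reducedFrame φ y' i = ∑ j, (C * M).adjugate i j • ∑ l, C j l • y l := by
        rw [reducedFrame, h1]
        simp only [hC]
    _ = ∑ l, ((C * M).adjugate * C) i l • y l := by
        simp only [Finset.smul_sum, smul_smul, Matrix.mul_apply, Finset.sum_smul]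
        exact Finset.sum_comm
    _ = C.det • reducedFrame φ y i := by
        rw [h2]
        simp [reducedFrame, Finset.smul_sum, smul_smul, hM]

theorem exists_change_of_frame {y y' : Fin n → E} (hy' : LinearIndependent ℝ y')
    (h : ∀ i, y' i ∈ Submodule.span ℝ (Set.range y)) :
    ∃ C : Matrix (Fin n) (Fin n) ℝ, C.det ≠ 0 ∧ ∀ i, y' i = ∑ j, C i j • y j := by
  choose C hC using fun i => (Submodule.mem_span_range_iff_exists_fun ℝ).1 (h i)
  refine ⟨Matrix.of C, fun hdet => ?_, fun i => (hC i).symm⟩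
  obtain ⟨w, hw, hwC⟩ := Matrix.exists_vecMul_eq_zero_iff.2 hdet
  refine hw (funext (Fintype.linearIndependent_iff.1 hy' w ?_))
  calc ∑ i, w i • y' i = ∑ j, (∑ i, w i * C i j) • y j := by
        simp only [← hC, Finset.smul_sum, smul_smul, Finset.sum_smul]
        exact Finset.sum_comm
    _ = 0 := by
        refine Finset.sum_eq_zero fun j _ => ?_
        have := congrFun hwC j
        simp only [Matrix.vecMul, dotProduct, Matrix.of_apply, Pi.zero_apply] at this
        rw [this, zero_smul]

theorem contDiff_reducedFrame {F : Type*} [NormedAddCommGroup F] [NormedSpace ℝ F]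
    (φ : Fin n → E →L[ℝ] ℝ) {y : F → Fin n → E} (hy : ∀ i, ContDiff ℝ ω fun x => y x i)
    (i : Fin n) : ContDiff ℝ ω fun x => reducedFrame φ (y x) i := by
  refine ContDiff.sum fun j _ => ContDiff.smul ?_ (hy j)
  exact ContDiff.matrix_adjugate (fun a b => (φ b).contDiff.comp (hy a)) i j

/-- Linearly independent vectors have a dual family of functionals. -/
theorem exists_dual_functionals [FiniteDimensional ℝ E] {x : Fin n → E}
    (hx : LinearIndependent ℝ x) :
    ∃ φ : Fin n → E →L[ℝ] ℝ, ∀ i j, φ j (x i) = if i = j then 1 else 0 := by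
  choose ψ hψ using fun j => LinearMap.exists_extend ((Basis.span hx).coord j)
  refine ⟨fun j => LinearMap.toContinuousLinearMap (ψ j), fun i j => ?_⟩
  have h1 : (Basis.span hx i : E) = x i := by simp
  calc ψ j (x i) = (ψ j ∘ₗ Submodule.subtype _) (Basis.span hx i) := by simp
    _ = (Basis.span hx).coord j (Basis.span hx i) := by rw [hψ]
    _ = _ := by simp [Finsupp.single_apply]

end ReducedFrame

/-! ### Frames with generic reduced vectors -/

section GenericFrames

theorem GenericVectors.smul {J V : Type*} [NormedAddCommGroup V] [InnerProductSpace ℝ V]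
    {v v' : J → V} (hv : GenericVectors v) (c : J → ℝ) (hc : ∀ j, c j ≠ 0)
    (h : ∀ j, v' j = c j • v j) : GenericVectors v' := by
  intro s hs
  convert (hv s hs).units_smul fun j => Units.mk0 (c j) (hc j) using 1
  ext1 j
  simp [h, Units.smul_def]

/-- Points on the moment curve are generic vectors. -/
theorem exists_genericVectors (J : Type*) [Finite J] (m : ℕ) :
    ∃ x : J → EuclideanSpace ℝ (Fin m), GenericVectors x := by
  obtain ⟨N, ⟨e⟩⟩ := Finite.exists_equiv_fin J
  refine ⟨fun j => WithLp.toLp 2 fun i : Fin m => ((e j : ℕ) : ℝ) ^ (i : ℕ), fun s hs => ?_⟩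
  rw [finrank_euclideanSpace_fin] at hs
  -- the first `s.card` coordinates form a Vandermonde matrix
  let L : EuclideanSpace ℝ (Fin m) →ₗ[ℝ] (Fin s.card → ℝ) :=
    { toFun := fun u i => u (Fin.castLE hs i)
      map_add' := fun _ _ => rfl
      map_smul' := fun _ _ => rfl }
  refine LinearIndependent.of_comp L ?_
  rw [← linearIndependent_equiv s.equivFin.symm]
  have hdet : (Matrix.vandermonde fun i : Fin s.card =>
      ((e (s.equivFin.symm i) : ℕ) : ℝ)).det ≠ 0 := by
    rw [Matrix.det_vandermonde_ne_zero_iff]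
    intro a b hab
    exact s.equivFin.symm.injective
      (Subtype.ext (e.injective (Fin.ext (Nat.cast_injective hab))))
  exact Matrix.linearIndependent_rows_of_det_ne_zero hdet

variable {I : Type*} {m : ℕ} {κ : I → ℕ}

/-- Families consisting of `κ α` vectors for each `α`. -/
abbrev FrameFamily (m : ℕ) (κ : I → ℕ) : Type _ := ∀ α, Fin (κ α) → EuclideanSpace ℝ (Fin m)

/-- The reduced frames of all blocks of a family, as one family of vectors. -/
noncomputable def reducedVectors (φ : ∀ α, Fin (κ α) → EuclideanSpace ℝ (Fin m) →L[ℝ] ℝ)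
    (y : FrameFamily m κ) (j : Σ α, Fin (κ α)) : EuclideanSpace ℝ (Fin m) :=
  reducedFrame (φ j.1) (y j.1) j.2

open scoped Classical in
/-- The product of the Gram determinants of all subfamilies of at most `m` reduced vectors. It is
nonzero if and only if the reduced vectors are generic. -/
noncomputable def genericityFunction [Fintype I]
    (φ : ∀ α, Fin (κ α) → EuclideanSpace ℝ (Fin m) →L[ℝ] ℝ)
    (y : FrameFamily m κ) : ℝ :=
  ∏ s : Finset (Σ α, Fin (κ α)) with s.card ≤ m,
    (Matrix.gram ℝ fun j : s => reducedVectors φ y j).det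

theorem genericityFunction_ne_zero [Fintype I]
    {φ : ∀ α, Fin (κ α) → EuclideanSpace ℝ (Fin m) →L[ℝ] ℝ}
    {y : FrameFamily m κ} :
    genericityFunction φ y ≠ 0 ↔ GenericVectors (reducedVectors φ y) := by
  simp [genericityFunction, Finset.prod_ne_zero_iff, GenericVectors,
    Matrix.det_gram_ne_zero_iff_linearIndependent]

theorem contDiff_genericityFunction [Fintype I] {F : Type*} [NormedAddCommGroup F] [NormedSpace ℝ F]
    (φ : ∀ α, Fin (κ α) → EuclideanSpace ℝ (Fin m) →L[ℝ] ℝ) {y : F → FrameFamily m κ}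
    (hy : ∀ α i, ContDiff ℝ ω fun x => y x α i) :
    ContDiff ℝ ω fun x => genericityFunction φ (y x) := by
  classical
  refine contDiff_prod fun s _ => ContDiff.matrix_det fun a b => ?_
  exact (contDiff_reducedFrame _ (hy _) _).inner ℝ (contDiff_reducedFrame _ (hy _) _)

/-- `y` consists of bases of the orthogonal complements of the subspaces in `Q`. -/
def IsNormalFrame (Q : GrassmannProduct m κ) (y : FrameFamily m κ) : Prop :=
  ∀ α, LinearIndependent ℝ (y α) ∧ ∀ i, y α i ∈ (Q α).toSubmoduleᗮ

theorem finrank_orthogonal_grassmannian {k : ℕ}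
    (W : Grassmannian ℝ (EuclideanSpace ℝ (Fin m)) k) :
    finrank ℝ W.toSubmoduleᗮ = k := by
  have h1 := codim_add_finrank W.toSubmodule
  have h2 := Submodule.finrank_add_finrank_orthogonal W.toSubmodule
  rw [codim_grassmannian] at h1
  omega

/-- Genericity of the reduced vectors does not depend on the normal frame. -/
theorem IsNormalFrame.genericVectors {Q : GrassmannProduct m κ} {y y' : FrameFamily m κ}
    (hy : IsNormalFrame Q y) (hy' : IsNormalFrame Q y')
    {φ : ∀ α, Fin (κ α) → EuclideanSpace ℝ (Fin m) →L[ℝ] ℝ}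
    (h : GenericVectors (reducedVectors φ y)) : GenericVectors (reducedVectors φ y') := by
  have hspan (α : I) : Submodule.span ℝ (Set.range (y α)) = (Q α).toSubmoduleᗮ := by
    refine Submodule.eq_of_le_of_finrank_eq ?_ ?_
    · rw [Submodule.span_le]
      rintro _ ⟨i, rfl⟩
      exact (hy α).2 i
    · rw [finrank_span_eq_card (hy α).1, finrank_orthogonal_grassmannian, Fintype.card_fin]
  choose C hdet hC using fun α => exists_change_of_frame (y := y α) (hy' α).1
    fun i => (hspan α).symm ▸ (hy' α).2 i
  exact h.smul (fun j => (C j.1).det) (fun j => hdet j.1)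
    fun j => reducedFrame_change (φ j.1) (C j.1) (hC j.1) j.2

end GenericFrames

/-! ### Normal frames in the charts of the product of Grassmannians -/

section GraphChart

variable {I : Type*} {m : ℕ} {κ : I → ℕ}

/-- An orthonormal basis of the orthogonal complement of a point of a Grassmannian. -/
noncomputable def normalBasis {k : ℕ} (W : Grassmannian ℝ (EuclideanSpace ℝ (Fin m)) k) :
    OrthonormalBasis (Fin k) ℝ W.toSubmoduleᗮ :=
  (stdOrthonormalBasis ℝ _).reindex (finCongr (finrank_orthogonal_grassmannian W))

/-- The graphs of the maps `f α` have the normal vectors `z - (f α)† z`, where `z` runs through an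
orthonormal basis of the complement of `p α`. -/
noncomputable def chartFrame (p : GrassmannProduct m κ) (f : ChartSpace p) : FrameFamily m κ :=
  fun α i => (normalBasis (p α) i : EuclideanSpace ℝ (Fin m)) -
    (ContinuousLinearMap.adjoint (f α) (normalBasis (p α) i) : EuclideanSpace ℝ (Fin m))

theorem mem_orthogonal_graphSubspace {W : Submodule ℝ (EuclideanSpace ℝ (Fin m))}
    {f : W →L[ℝ] Wᗮ} {u : EuclideanSpace ℝ (Fin m)} {a : Wᗮ}
    (hu : u = (a : EuclideanSpace ℝ (Fin m)) - (ContinuousLinearMap.adjoint f a : W)) :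
    u ∈ (graphSubspace W f)ᗮ := by
  rw [Submodule.mem_orthogonal]
  rintro _ ⟨w, rfl⟩
  have h1 : inner ℝ (w : EuclideanSpace ℝ (Fin m)) (a : EuclideanSpace ℝ (Fin m)) = 0 :=
    (Submodule.mem_orthogonal _ _).1 a.2 w w.2
  have h2 : inner ℝ (f w : EuclideanSpace ℝ (Fin m))
      ((ContinuousLinearMap.adjoint f a : W) : EuclideanSpace ℝ (Fin m)) = 0 :=
    (Submodule.mem_orthogonal' _ _).1 (f w).2 _ (Submodule.coe_mem _)
  have h3 : inner ℝ (f w : EuclideanSpace ℝ (Fin m)) (a : EuclideanSpace ℝ (Fin m)) =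
      inner ℝ (w : EuclideanSpace ℝ (Fin m))
        ((ContinuousLinearMap.adjoint f a : W) : EuclideanSpace ℝ (Fin m)) :=
    (ContinuousLinearMap.adjoint_inner_right f w a).symm
  simp only [LinearMap.add_apply, LinearMap.comp_apply, Submodule.subtype_apply, hu,
    ContinuousLinearMap.coe_coe, inner_add_left, inner_sub_right]
  linarith

theorem isNormalFrame_chartFrame (p : GrassmannProduct m κ) (f : ChartSpace p) :
    IsNormalFrame (graphChart p f) (chartFrame p f) := by
  refine fun α => ⟨?_, fun i => mem_orthogonal_graphSubspace rfl⟩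
  refine LinearIndependent.of_comp
    ((p α).toSubmoduleᗮ.orthogonalProjectionOnto : _ →ₗ[ℝ] (p α).toSubmoduleᗮ) ?_
  have h : (fun u => (p α).toSubmoduleᗮ.orthogonalProjectionOnto u) ∘ chartFrame p f α =
      normalBasis (p α) := by
    ext1 i
    simp [chartFrame]
  exact h ▸ (normalBasis (p α)).orthonormal.linearIndependent

theorem contDiff_chartFrame [Fintype I] (p : GrassmannProduct m κ) (α : I) (i : Fin (κ α)) :
    ContDiff ℝ ω fun f : ChartSpace p => chartFrame p f α i := by
  let L : ((p α).toSubmodule →L[ℝ] (p α).toSubmoduleᗮ) →ₗ[ℝ] (p α).toSubmodule :=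
    { toFun := fun f => ContinuousLinearMap.adjoint f (normalBasis (p α) i)
      map_add' := fun f g => by simp
      map_smul' := fun c f => by simp }
  have hα : ContDiff ℝ ω fun f : ChartSpace p => f α := contDiff_pi.1 contDiff_id α
  have hL : ContDiff ℝ ω (LinearMap.toContinuousLinearMap L) := ContinuousLinearMap.contDiff _
  exact contDiff_const.sub ((p α).toSubmodule.subtypeL.contDiff.comp (hL.comp hα))

/-- If the components of `y` in the complement of `W` form a basis there, then `y` is a normal frame
of the graph of a linear map. -/
theorem exists_graph_of_frame {k : ℕ} (W : Grassmannian ℝ (EuclideanSpace ℝ (Fin m)) k)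
    {y : Fin k → EuclideanSpace ℝ (Fin m)}
    (hy : (Matrix.of fun i j =>
      inner ℝ (normalBasis W j : EuclideanSpace ℝ (Fin m)) (y i)).det ≠ 0) :
    ∃ f : W.toSubmodule →L[ℝ] W.toSubmoduleᗮ, LinearIndependent ℝ y ∧
      ∀ i, y i ∈ (graphSubspace W.toSubmodule f)ᗮ := by
  let P : EuclideanSpace ℝ (Fin m) →ₗ[ℝ] W.toSubmoduleᗮ := W.toSubmoduleᗮ.orthogonalProjectionOnto
  let c : W.toSubmoduleᗮ →ₗ[ℝ] (Fin k → ℝ) :=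
    { toFun := fun u j => inner ℝ (normalBasis W j) u
      map_add' := fun u v => by ext; simp [inner_add_right]
      map_smul' := fun r u => by ext; simp [inner_smul_right] }
  have hPy : LinearIndependent ℝ fun i => P (y i) := by
    refine LinearIndependent.of_comp c ?_
    have h : (fun u => c u) ∘ (fun i => P (y i)) = fun i j =>
        inner ℝ (normalBasis W j : EuclideanSpace ℝ (Fin m)) (y i) := by
      ext i j
      exact Submodule.inner_orthogonalProjectionOnto_eq_of_mem_left (K := W.toSubmoduleᗮ) _ _
    exact h ▸ Matrix.linearIndependent_rows_of_det_ne_zero hy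
  let b := basisOfLinearIndependentOfCardEqFinrank' _ hPy
    (by rw [Fintype.card_fin, finrank_orthogonal_grassmannian])
  -- the graph of `g†` has the normal vectors `z - g z`; so `g` has to send the component of `y i`
  -- in the complement of `W` to minus its component in `W`
  let g : W.toSubmoduleᗮ →ₗ[ℝ] W.toSubmodule :=
    b.constr ℝ fun i => -W.toSubmodule.orthogonalProjectionOnto (y i)
  have hg (i) : g (P (y i)) = -W.toSubmodule.orthogonalProjectionOnto (y i) := by
    have hb : b i = P (y i) := by simp [b]
    rw [← hb]
    exact b.constr_basis ℝ _ i
  refine ⟨ContinuousLinearMap.adjoint (LinearMap.toContinuousLinearMap g),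
    LinearIndependent.of_comp P hPy, fun i => mem_orthogonal_graphSubspace (a := P (y i)) ?_⟩
  rw [ContinuousLinearMap.adjoint_adjoint]
  change y i = (P (y i) : EuclideanSpace ℝ (Fin m)) - (g (P (y i)) : W.toSubmodule)
  rw [hg, Submodule.coe_neg, sub_neg_eq_add, add_comm]
  exact (W.toSubmodule.starProjection_add_starProjection_orthogonal (y i)).symm

end GraphChart

/-! ### The exceptional subvariety -/

section NongenericLocus

variable {I : Type*} {m : ℕ} {κ : I → ℕ}

/-- The families of subspaces whose reduced normal vectors, with respect to the functionals `φ`, are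
not generic. Quantifying over all normal frames makes this independent of any choice, since
genericity for one normal frame implies genericity for all of them. -/
def nongenericLocus (φ : ∀ α, Fin (κ α) → EuclideanSpace ℝ (Fin m) →L[ℝ] ℝ) :
    Set (GrassmannProduct m κ) :=
  {Q | ∀ y, IsNormalFrame Q y → ¬ GenericVectors (reducedVectors φ y)}

theorem notMem_nongenericLocus_iff {φ : ∀ α, Fin (κ α) → EuclideanSpace ℝ (Fin m) →L[ℝ] ℝ}
    {Q : GrassmannProduct m κ} {y : FrameFamily m κ} (hy : IsNormalFrame Q y) :
    Q ∉ nongenericLocus φ ↔ GenericVectors (reducedVectors φ y) := by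
  simp only [nongenericLocus, Set.mem_ofPred_eq, not_forall, not_not]
  exact ⟨fun ⟨_, hy', h⟩ => hy'.genericVectors hy h, fun h => ⟨y, hy, h⟩⟩

variable [Fintype I]

theorem graphChart_mem_nongenericLocus_iff
    {φ : ∀ α, Fin (κ α) → EuclideanSpace ℝ (Fin m) →L[ℝ] ℝ} {p : GrassmannProduct m κ}
    (f : ChartSpace p) :
    graphChart p f ∈ nongenericLocus φ ↔ genericityFunction φ (chartFrame p f) = 0 := by
  rw [← not_iff_not, notMem_nongenericLocus_iff (isNormalFrame_chartFrame p f)]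
  exact genericityFunction_ne_zero.symm

theorem isAnalyticSubvariety_nongenericLocus
    (φ : ∀ α, Fin (κ α) → EuclideanSpace ℝ (Fin m) →L[ℝ] ℝ) :
    IsAnalyticSubvariety (nongenericLocus φ) := by
  refine fun p => ⟨Set.univ, isOpen_univ, Set.mem_univ _, 1,
    fun _ f => genericityFunction φ (chartFrame p f), fun _ => ?_, fun f _ => ?_⟩
  · exact contDiff_omega_iff_analyticOnNhd.1
      (contDiff_genericityFunction φ fun α i => contDiff_chartFrame p α i)
  · rw [graphChart_mem_nongenericLocus_iff]
    simp

/-- If the genericity function is nonzero on some family of frames, then it is nonzero on a family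
of normal frames of a point of any given chart, because the frames that come from the chart are
those where another analytic function does not vanish. -/
theorem hasPositiveCodimension_nongenericLocus
    {φ : ∀ α, Fin (κ α) → EuclideanSpace ℝ (Fin m) →L[ℝ] ℝ} {x : FrameFamily m κ}
    (hx : GenericVectors (reducedVectors φ x)) :
    HasPositiveCodimension (nongenericLocus φ) := by
  intro p
  rw [Set.eq_empty_iff_forall_notMem]
  intro f hf
  have hcoord (α : I) (i : Fin (κ α)) : ContDiff ℝ ω fun y : FrameFamily m κ => y α i :=
    contDiff_pi.1 (contDiff_pi.1 contDiff_id α) i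
  -- by the identity theorem, an interior point makes the function vanish on the whole chart
  have hzero : ∀ f, genericityFunction φ (chartFrame p f) = 0 :=
    eq_zero_of_contDiff_of_eventuallyEq (a := f)
      (contDiff_genericityFunction φ fun α i => contDiff_chartFrame p α i) (by
        filter_upwards [mem_interior_iff_mem_nhds.1 hf] with f hf
        exact (graphChart_mem_nongenericLocus_iff f).1 hf)
  -- `D y ≠ 0` says that `y` is a normal frame of a point of the chart; it holds at the frame of `p`
  let D : FrameFamily m κ → ℝ := fun y => ∏ α, (Matrix.of fun i j =>
    inner ℝ (normalBasis (p α) j : EuclideanSpace ℝ (Fin m)) (y α i)).det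
  have hD : ContDiff ℝ ω D := contDiff_prod fun α _ => ContDiff.matrix_det fun i j =>
    contDiff_const.inner ℝ (hcoord α i)
  have hD1 : D (fun α i => normalBasis (p α) i) ≠ 0 := by
    refine Finset.prod_ne_zero_iff.2 fun α _ => ?_
    have h : (Matrix.of fun i j => inner ℝ (normalBasis (p α) j : EuclideanSpace ℝ (Fin m))
        (normalBasis (p α) i : EuclideanSpace ℝ (Fin m))) = 1 := by
      ext i j
      rw [Matrix.of_apply, ← Submodule.coe_inner,
        orthonormal_iff_ite.1 (normalBasis (p α)).orthonormal, Matrix.one_apply]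
      simp [eq_comm]
    rw [h, Matrix.det_one]
    exact one_ne_zero
  obtain ⟨y, hy, hyD⟩ := exists_ne_zero_and_ne_zero
    (contDiff_genericityFunction φ hcoord) hD (genericityFunction_ne_zero.2 hx) hD1
  choose f hf using fun α =>
    exists_graph_of_frame (p α) (Finset.prod_ne_zero_iff.1 hyD α (Finset.mem_univ α))
  have hframe : IsNormalFrame (graphChart p f) y := hf
  exact (notMem_nongenericLocus_iff hframe).2 (genericityFunction_ne_zero.1 hy)
    ((graphChart_mem_nongenericLocus_iff f).2 (hzero f))

end NongenericLocus

/-! ### Resolutions outside the exceptional subvariety -/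

/-- A snarl with generic normal vectors `v ⟨α, i⟩` is the labelled snarl of these vectors: the
`κ α` vectors for `α` are independent, so they span all normals of the subspace `Q α`. -/
theorem toSnarl_eq_labelledSnarl {ι : Type*} [DecidableEq ι] {m : ℕ} {A : Finset ι} {κ : A → ℕ}
    (hκ : ∀ α, 1 ≤ κ α ∧ κ α ≤ m - 1) {Q : GrassmannProduct m κ}
    {v : (Σ α, Fin (κ α)) → EuclideanSpace ℝ (Fin m)} (hv : GenericVectors v)
    (hvQ : ∀ j, v j ∈ (Q j.1).toSubmoduleᗮ)
    (hcard : ∀ α : A, (labelFiber (fun j : Σ α, Fin (κ α) => (j.1 : ι)) α).card = κ α)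
    (hπ : ∀ α, (labelFiber (fun j : Σ α, Fin (κ α) => (j.1 : ι)) α).card <
      finrank ℝ (EuclideanSpace ℝ (Fin m))) :
    GrassmannProduct.toSnarl hκ Q = labelledSnarl hv (fun j => (j.1 : ι)) hπ := by
  refine Snarl.ext_space ?_ fun α hS _ => ?_
  · ext α
    change α ∈ A ↔ α ∈ Finset.univ.image fun j : Σ α, Fin (κ α) => (j.1 : ι)
    simp only [Finset.mem_image, Finset.mem_univ, true_and]
    refine ⟨fun h => ⟨⟨⟨α, h⟩, ⟨0, (hκ ⟨α, h⟩).1⟩⟩, rfl⟩, ?_⟩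
    rintro ⟨j, rfl⟩
    exact j.1.2
  · change α ∈ A at hS
    change (Q ⟨α, hS⟩).toSubmodule = commonOrthogonal v (labelFiber _ α)
    have hα := hcard ⟨α, hS⟩
    refine Submodule.eq_of_le_of_finrank_eq (fun u hu => ?_) ?_
    · rw [mem_commonOrthogonal]
      rintro ⟨⟨β, hβ⟩, i⟩ hj
      obtain rfl : β = α := mem_labelFiber.1 hj
      exact (Submodule.mem_orthogonal' _ _).1 (hvQ ⟨⟨β, hβ⟩, i⟩) u hu
    · have h1 := codim_add_finrank (Q ⟨α, hS⟩).toSubmodule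
      have h2 := codim_add_finrank
        (commonOrthogonal v (labelFiber (fun j : Σ α, Fin (κ α) => (j.1 : ι)) α))
      have h3 := hπ α
      rw [codim_commonOrthogonal hv] at h2
      rw [codim_grassmannian] at h1
      dsimp only at hα
      omega

theorem proposition3p3 {ι : Type*} [DecidableEq ι] [Infinite ι] (m : ℕ) (hm : 1 < m)
    (A : Finset ι) (κ : A → ℕ) (hκ : ∀ α, 1 ≤ κ α ∧ κ α ≤ m - 1)
    (hsum : 2 * Finset.univ.sup κ + ∑ α, κ α ≤ 2 * m)
    (hA : 3 ≤ A.card ∨ ∀ α, κ α = 1) :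
    ∃ X : Set (GrassmannProduct m κ), IsAnalyticSubvariety X ∧ HasPositiveCodimension X ∧
      ∀ Q : GrassmannProduct m κ, Q ∉ X →
        ∃ (N : ℕ) (c : Fin (N + 1) → Snarl ι (EuclideanSpace ℝ (Fin m))),
          (GrassmannProduct.toSnarl hκ Q).IsResolution N c ∧
            (c (Fin.last N)).IsInGeneralPosition := by
  obtain ⟨x, hx⟩ := exists_genericVectors (Σ α, Fin (κ α)) m
  have hind (α : A) : LinearIndependent ℝ fun i => x ⟨α, i⟩ := by
    have h := hx (Finset.univ.map (Function.Embedding.sigmaMk α)) (by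
      rw [Finset.card_map, Finset.card_univ, Fintype.card_fin, finrank_euclideanSpace_fin]
      have := hκ α
      omega)
    exact h.comp (fun i : Fin (κ α) => ⟨⟨α, i⟩, Finset.mem_map_of_mem _ (Finset.mem_univ i)⟩)
      fun i j hij =>
      (Function.Embedding.sigmaMk α).injective (congrArg Subtype.val hij)
  choose φ hφ using fun α => exists_dual_functionals (hind α)
  have hred : reducedVectors φ (fun α i => x ⟨α, i⟩) = x :=
    funext fun j => congrFun (reducedFrame_eq_self (hφ j.1)) j.2
  refine ⟨nongenericLocus φ, isAnalyticSubvariety_nongenericLocus φ,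
    hasPositiveCodimension_nongenericLocus (hred.symm ▸ hx), fun Q hQ => ?_⟩
  simp only [nongenericLocus, Set.mem_ofPred_eq, not_forall, not_not] at hQ
  obtain ⟨y, hy, hgen⟩ := hQ
  have hcard (α : A) : (labelFiber (fun j : Σ α, Fin (κ α) => (j.1 : ι)) α).card = κ α := by
    have h : labelFiber (fun j : Σ α, Fin (κ α) => (j.1 : ι)) α =
        Finset.univ.map (Function.Embedding.sigmaMk α) := by
      ext ⟨β, i⟩
      simp only [mem_labelFiber, Finset.mem_map, Finset.mem_univ, true_and,
        Function.Embedding.sigmaMk_apply]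
      constructor
      · intro h
        obtain rfl := Subtype.ext h
        exact ⟨i, rfl⟩
      · rintro ⟨j, hj⟩
        exact congrArg (fun j : Σ α, Fin (κ α) => (j.1 : ι)) hj.symm
    rw [h, Finset.card_map, Finset.card_univ, Fintype.card_fin]
  have hle {b : ℕ} (hb : ∀ α, κ α ≤ b) (α : ι) :
      (labelFiber (fun j : Σ α, Fin (κ α) => (j.1 : ι)) α).card ≤ b := by
    by_cases hα : α ∈ A
    · exact (hcard ⟨α, hα⟩).trans_le (hb _)
    · have h : labelFiber (fun j : Σ α, Fin (κ α) => (j.1 : ι)) α = ∅ :=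
        Finset.eq_empty_of_forall_notMem fun j hj => hα (mem_labelFiber.1 hj ▸ j.1.2)
      rw [h, Finset.card_empty]
      exact Nat.zero_le b
  have hπ (α : ι) : (labelFiber (fun j : Σ α, Fin (κ α) => (j.1 : ι)) α).card <
      finrank ℝ (EuclideanSpace ℝ (Fin m)) := by
    rw [finrank_euclideanSpace_fin]
    have := hle (fun α => (hκ α).2) α
    omega
  have hS := toSnarl_eq_labelledSnarl hκ hgen (fun j => reducedFrame_mem (hy j.1).2 j.2) hcard hπ
  rw [hS]
  refine labelledSnarl_exists_resolution hgen ?_ _ hπ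
    (hle fun α => Finset.le_sup (Finset.mem_univ α)) ?_
  · rwa [finrank_euclideanSpace_fin, Fintype.card_sigma,
      Finset.sum_congr rfl fun α _ => Fintype.card_fin (κ α)]
  · refine hA.imp (fun h => ?_) fun h => hle fun α => (h α).le
    have hindex : A = Finset.univ.image fun j : Σ α, Fin (κ α) => (j.1 : ι) :=
      congrArg Snarl.index hS
    rwa [← hindex]
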